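/- Let $p$ be a prime, let $k$ be a field of characteristic $p$ with the discrete topology, and let $G$ be a profinite group. Let $k[[G]]=\varprojlim_N k[G/N]$ be the completed group algebra, where $N$ runs over the open normal subgroups of $G$ and each $k[G/N]$ is discrete. A pseudocompact $k[[G]]$-module is a topological $k[[G]]$-module $U$ having a basis of neighbourhoods of $0$ consisting of open submodules $V$ of finite $k$-codimension that intersect in $0$, and such that $U=\varprojlim_V U/V$. A block of $G$ is an ideal $B=k[[G]]e$, where $e$ is a centrally primitive idempotent of $k[[G]]$ (a nonzero idempotent of the centre of $k[[G]]$ that is not the sum of two nonzero orthogonal idempotents of the centre); $e$ is the block idempotent of $B$. A $k[[G]]$-module $U$ lies in $B$ if $BU=U$ and $B'U=0$ for every block $B'\neq B$. For a subgroup $H$ of $G$ let $k[[G]]^H=\{a\in k[[G]] : hah^{-1}=a \text{ for all } h\in H\}$, and for $H$ open let $\mathrm{Tr}_H^G:k[[G]]^H\to k[[G]]^G$ be the map $a\mapsto\sum_{g\in G/H}gag^{-1}$. A defect group of the block $B$ with block idempotent $e$ is a closed subgroup $D$ of $G$ that is minimal among the closed subgroups $H$ of $G$ such that $$e\in\bigcap_{N}\mathrm{Tr}_{HN}^G\big(k[[G]]^{HN}\big),$$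 where $N$ runs over the open normal subgroups of $G$. For a closed subgroup $H$ of $G$, a pseudocompact $k[[G]]$-module $U$ is relatively $H$-projective if, for all pseudocompact $k[[G]]$-modules $V,W$, every continuous $k[[G]]$-homomorphism $\varphi:U\to W$ and every surjective continuous $k[[G]]$-homomorphism $\beta:V\to W$, the existence of a continuous $k[[H]]$-homomorphism $\gamma:U\to V$ with $\beta\gamma=\varphi$ implies the existence of a continuous $k[[G]]$-homomorphism $\gamma':U\to V$ with $\beta\gamma'=\varphi$. **Proposition.** If $B$ is a block of $G$ with defect group $D$, then every finitely generated pseudocompact $k[[G]]$-module lying in $B$ is relatively $D$-projective. -/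

import Mathlib

open scoped Topology

universe uk uG uA uU uV uW

noncomputable section

/-! ### The completed group algebra -/

section CompletedGroupAlgebra

variable (k : Type uk) [Field k] (G : Type uG) [Group G] [TopologicalSpace G]

/-- The finite-level group algebra `k[G/N]` for an open normal subgroup `N` of `G`. -/
abbrev FiniteLevel (N : OpenNormalSubgroup G) : Type (max uk uG) :=
  MonoidAlgebra k (G ⧸ N.toSubgroup)

variable {G} in
/-- The canonical projection `k[G/N] → k[G/M]` for `N ≤ M`. -/
def transition {N M : OpenNormalSubgroup G} (h : N ≤ M) :
    FiniteLevel k G N →ₐ[k] FiniteLevel k G M :=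
  MonoidAlgebra.mapDomainAlgHom k k
    (QuotientGroup.map N.toSubgroup M.toSubgroup (MonoidHom.id G) h)

/-- The compatible families in `∏ N, k[G/N]`, as a subalgebra. -/
def compatibleFamilies : Subalgebra k (∀ N : OpenNormalSubgroup G, FiniteLevel k G N) where
  carrier := {x | ∀ (N M : OpenNormalSubgroup G) (h : N ≤ M), transition k h (x N) = x M}
  mul_mem' := by
    intro a b ha hb N M h
    simp only [Pi.mul_apply, map_mul, ha N M h, hb N M h]
  add_mem' := by
    intro a b ha hb N M h
    simp only [Pi.add_apply, map_add, ha N M h, hb N M h]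
  algebraMap_mem' := by
    intro r N M h
    simp only [Pi.algebraMap_apply, AlgHom.commutes]

/-- The completed group algebra `k[[G]] = lim k[G/N]`, the inverse limit over the open normal
subgroups `N` of `G`. -/
def CompletedGroupAlgebra : Type (max uk uG) := ↥(compatibleFamilies k G)

instance : Ring (CompletedGroupAlgebra k G) :=
  inferInstanceAs (Ring ↥(compatibleFamilies k G))

instance : Algebra k (CompletedGroupAlgebra k G) :=
  inferInstanceAs (Algebra k ↥(compatibleFamilies k G))

/-- The inverse limit topology, each `k[G/N]` being discrete. -/
instance : TopologicalSpace (CompletedGroupAlgebra k G) :=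
  TopologicalSpace.induced
    (fun x : CompletedGroupAlgebra k G => (x.1 : ∀ N : OpenNormalSubgroup G, FiniteLevel k G N))
    (@Pi.topologicalSpace _ _ fun _ => ⊥)

variable {G}

/-- The image of a group element `g` in `k[[G]]`. -/
def groupElement (g : G) : CompletedGroupAlgebra k G :=
  ⟨fun N => MonoidAlgebra.of k (G ⧸ N.toSubgroup) (QuotientGroup.mk g), by
    intro N M h
    simp only [transition, MonoidAlgebra.of_apply, MonoidAlgebra.mapDomainAlgHom_apply,
      MonoidAlgebra.mapDomain_single]
    rfl⟩

/-- The intersection with `H` of an open normal subgroup of `G`, as an open normal subgroup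
of `H`. -/
def interSubgroup (H : Subgroup G) (N : OpenNormalSubgroup G) : OpenNormalSubgroup H where
  toSubgroup := N.toSubgroup.comap H.subtype
  isOpen' := N.toOpenSubgroup.isOpen'.preimage continuous_subtype_val
  isNormal' := N.isNormal'.comap H.subtype

/-- The canonical homomorphism `k[[H]] → k[[G]]` for a subgroup `H` of `G`, given at level `N` by
`k[[H]] → k[H/(H ∩ N)] → k[G/N]`. -/
def inclusionAlgHom (H : Subgroup G) :
    CompletedGroupAlgebra k H →ₐ[k] CompletedGroupAlgebra k G :=
  AlgHom.codRestrict
    ((AlgHom.pi fun N : OpenNormalSubgroup G =>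
      (MonoidAlgebra.mapDomainAlgHom k k
        (QuotientGroup.map (interSubgroup H N).toSubgroup N.toSubgroup H.subtype le_rfl)).comp
        (Pi.evalAlgHom k (fun M : OpenNormalSubgroup H => FiniteLevel k H M)
          (interSubgroup H N))).comp (compatibleFamilies k H).val)
    (compatibleFamilies k G) (by
      intro x N M h
      have hx := x.2 (interSubgroup H N) (interSubgroup H M) (fun y hy => h hy)
      change transition k h (MonoidAlgebra.mapDomainAlgHom k k
          (QuotientGroup.map (interSubgroup H N).toSubgroup N.toSubgroup H.subtype le_rfl)
            (x.1 (interSubgroup H N))) =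
        MonoidAlgebra.mapDomainAlgHom k k
          (QuotientGroup.map (interSubgroup H M).toSubgroup M.toSubgroup H.subtype le_rfl)
            (x.1 (interSubgroup H M))
      rw [← hx]
      unfold transition
      rw [← AlgHom.comp_apply, ← AlgHom.comp_apply, ← MonoidAlgebra.mapDomainAlgHom_comp,
        ← MonoidAlgebra.mapDomainAlgHom_comp]
      congr 2
      ext y
      rfl)

/-- The conjugation action of `G` on `k[[G]]`. -/
def conjAction (g : G) (x : CompletedGroupAlgebra k G) : CompletedGroupAlgebra k G :=
  groupElement k g * x * groupElement k g⁻¹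

/-- The elements of `k[[G]]` fixed under conjugation by `H`. -/
def fixedPoints (H : Subgroup G) : Set (CompletedGroupAlgebra k G) :=
  {x | ∀ h ∈ H, conjAction k h x = x}

/-- The trace `∑_{g ∈ G/H} g a g⁻¹`, over a set of representatives of the left cosets of `H`.
It is used for open subgroups `H` of a compact group `G`, so that the sum is finite, and for `a`
fixed under conjugation by `H`, so that it does not depend on the representatives. -/
def traceMap (H : Subgroup G) (a : CompletedGroupAlgebra k G) : CompletedGroupAlgebra k G :=
  ∑ᶠ q : G ⧸ H, conjAction k q.out a

/-- The set `⋂ Tr_{HN}^G (k[[G]]^{HN})`, the intersection running over the open normal subgroups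
`N` of `G`. -/
def openTraceSet (H : Subgroup G) : Set (CompletedGroupAlgebra k G) :=
  ⋂ N : OpenNormalSubgroup G,
    traceMap k (H ⊔ N.toSubgroup) '' fixedPoints k (H ⊔ N.toSubgroup)

end CompletedGroupAlgebra

/-! ### Blocks -/

section Blocks

variable (A : Type uA) [Ring A]

variable {A} in
/-- `e` is a primitive idempotent of the centre of `A`: a nonzero central idempotent that is not a
sum of two nonzero orthogonal central idempotents. -/
structure IsCentrallyPrimitive (e : A) : Prop where
  mem_center : e ∈ Subring.center A
  isIdempotentElem : IsIdempotentElem e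
  ne_zero : e ≠ 0
  primitive : ∀ f ∈ Subring.center A, ∀ g ∈ Subring.center A,
    IsIdempotentElem f → IsIdempotentElem g → f * g = 0 → g * f = 0 → e = f + g → f = 0 ∨ g = 0

/-- A block of `A`, given by its block idempotent `e`. -/
structure Block where
  idempotent : A
  isCentrallyPrimitive : IsCentrallyPrimitive idempotent

variable {A}

/-- The block `A e` itself, as an ideal of `A`. -/
def Block.toIdeal (B : Block A) : Ideal A := Ideal.span {B.idempotent}

/-- The `A`-module `U` lies in the block `B` if `B U = U` and `B' U = 0` for every other block
`B'`. -/
def LiesInBlock (B : Block A) (U : Type uU) [AddCommGroup U] [Module A U] : Prop :=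
  B.toIdeal • (⊤ : Submodule A U) = ⊤ ∧
    ∀ B' : Block A, B' ≠ B → B'.toIdeal • (⊤ : Submodule A U) = ⊥

end Blocks

/-! ### Pseudocompact modules -/

section Pseudocompact

variable (k : Type uk) [Field k] (A : Type uA) [Ring A] [Algebra k A] [TopologicalSpace A]

/-- The open `A`-submodules of finite codimension over `k`. -/
def IsOpenCofinite {U : Type uU} [AddCommGroup U] [Module k U] [Module A U] [IsScalarTower k A U]
    [TopologicalSpace U] (V : Submodule A U) : Prop :=
  IsOpen (V : Set U) ∧ FiniteDimensional k (U ⧸ V)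

/-- Pseudocompact `A`-modules: topological `A`-modules `U` in which the open submodules `V` of
finite codimension form a basis of neighbourhoods of zero and intersect in zero, and for which
`U = lim U/V`. -/
structure IsPseudocompactModule (U : Type uU) [AddCommGroup U] [Module k U] [Module A U]
    [IsScalarTower k A U] [TopologicalSpace U] : Prop where
  isTopologicalAddGroup : IsTopologicalAddGroup U
  continuousSMul : ContinuousSMul A U
  hasBasis : (𝓝 (0 : U)).HasBasis (fun V : Submodule A U => IsOpenCofinite k A V)
    (fun V => (V : Set U))
  sInf_eq_bot : sInf {V : Submodule A U | IsOpenCofinite k A V} = ⊥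
  complete : ∀ x : (∀ V : {V : Submodule A U // IsOpenCofinite k A V}, U ⧸ V.1),
    (∀ (V V' : {V : Submodule A U // IsOpenCofinite k A V}) (h : V.1 ≤ V'.1),
      Submodule.factor h (x V) = x V') →
    ∃ u : U, ∀ V, Submodule.Quotient.mk u = x V

end Pseudocompact

/-! ### Relative projectivity and defect groups -/

section Main

variable (k : Type uk) [Field k] {G : Type uG} [Group G] [TopologicalSpace G]

/-- The additive map `f` between `k[[G]]`-modules is a continuous homomorphism of the restricted
`k[[H]]`-modules. -/
def IsContinuousRestrictedHom (H : Subgroup G)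
    {U : Type uU} [AddCommGroup U] [Module (CompletedGroupAlgebra k G) U] [TopologicalSpace U]
    {V : Type uV} [AddCommGroup V] [Module (CompletedGroupAlgebra k G) V] [TopologicalSpace V]
    (f : U →+ V) : Prop :=
  Continuous f ∧ ∀ (a : CompletedGroupAlgebra k H) (u : U),
    f (inclusionAlgHom k H a • u) = inclusionAlgHom k H a • f u

/-- The `k[[G]]`-module `U` is relatively `H`-projective: for all pseudocompact `k[[G]]`-modules
`V`, `W`, every continuous homomorphism `φ : U → W` and every continuous epimorphism `β : V → W`,
if `φ` lifts along `β` to a continuous `k[[H]]`-homomorphism `U → V`, then it lifts to a continuous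
`k[[G]]`-homomorphism `U → V`. -/
def IsRelativelyProjective (H : Subgroup G)
    (U : Type uU) [AddCommGroup U] [Module (CompletedGroupAlgebra k G) U]
    [TopologicalSpace U] : Prop :=
  ∀ (V : Type uV) [AddCommGroup V] [Module k V] [Module (CompletedGroupAlgebra k G) V]
    [IsScalarTower k (CompletedGroupAlgebra k G) V] [TopologicalSpace V]
    (W : Type uW) [AddCommGroup W] [Module k W] [Module (CompletedGroupAlgebra k G) W]
    [IsScalarTower k (CompletedGroupAlgebra k G) W] [TopologicalSpace W],
    IsPseudocompactModule k (CompletedGroupAlgebra k G) V →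
    IsPseudocompactModule k (CompletedGroupAlgebra k G) W →
    ∀ (φ : U →L[CompletedGroupAlgebra k G] W) (β : V →L[CompletedGroupAlgebra k G] W),
      Function.Surjective β →
      (∃ γ : U →+ V, IsContinuousRestrictedHom k H γ ∧ ∀ u, β (γ u) = φ u) →
      ∃ γ : U →L[CompletedGroupAlgebra k G] V, ∀ u, β (γ u) = φ u

variable {k}

/-- `D` is a defect group of the block `B`, with block idempotent `e`: a closed subgroup of `G`
which is minimal among the closed subgroups `H` such that `e ∈ ⋂ Tr_{HN}^G (k[[G]]^{HN})`, the
intersection running over the open normal subgroups `N` of `G`. -/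
def IsDefectGroup (B : Block (CompletedGroupAlgebra k G)) (D : Subgroup G) : Prop :=
  Minimal (fun H : Subgroup G => IsClosed (H : Set G) ∧ B.idempotent ∈ openTraceSet k H) D

end Main

end

noncomputable section

/-! ### Inverse limits of finite-dimensional vector spaces -/

/-! Let `γ` be a continuous `k[[D]]`-lift of `φ` along `β`. Modulo an open submodule `V'` of finite
codimension in `V`, `γ` kills an open submodule of `U`, so for small enough `N` it is
`DN`-equivariant. If `e = Tr_{DN}^G(a)`, then `u ↦ ∑ g a γ(g⁻¹u)` is a `G`-homomorphism `U → V/V'`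
lifting `e φ`, which is `φ` because `e` acts as the identity on `U`
(`exists_lift_mod_isOpenCofinite`).

These lifts depend on choices and need not be compatible as `V'` varies. For each `V'`, however, the
lifts with open kernel form a nonempty affine space, of finite dimension since `U` is finitely
generated, and an inverse limit of such spaces is nonempty. To stay within linear algebra, the
affine space is taken as the fibre over `1` of the scalar coordinate on `scaledLifts`;
`exists_compatible_family_eq_one` gives the limit point by duality. A compatible family of lifts is
a map into `lim V/V' = V`, and `exists_continuous_lift` assembles it. -/

/-- A compatible family of linear functionals on an inverse system of finite-dimensional spaces,
each of which takes the value `1`, takes the value `1` at a compatible family of vectors. -/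
theorem exists_compatible_family_eq_one {k : Type*} [Field k] {ι : Type*} [Preorder ι]
    [IsDirectedOrder ι] (H : ι → Type*) [∀ i, AddCommGroup (H i)] [∀ i, Module k (H i)]
    [∀ i, FiniteDimensional k (H i)] (τ : ∀ i j, i ≤ j → H j →ₗ[k] H i)
    (τ_self : ∀ i x, τ i i le_rfl x = x)
    (τ_comp : ∀ i j l (hij : i ≤ j) (hjl : j ≤ l) x, τ i j hij (τ j l hjl x) = τ i l (hij.trans hjl) x)
    (ρ : ∀ i, H i →ₗ[k] k) (hρ : ∀ i j hij x, ρ i (τ i j hij x) = ρ j x)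
    (hne : ∀ i, ∃ x, ρ i x = 1) :
    ∃ x : ∀ i, H i, (∀ i j hij, τ i j hij (x j) = x i) ∧ ∀ i, ρ i (x i) = 1 := by
  classical
  rcases isEmpty_or_nonempty ι with h | ⟨⟨i₀⟩⟩
  · exact ⟨fun i => isEmptyElim i, fun i => isEmptyElim i, fun i => isEmptyElim i⟩
  let f : ∀ i j, i ≤ j → Module.Dual k (H i) →ₗ[k] Module.Dual k (H j) :=
    fun i j h => (τ i j h).dualMap
  have : DirectedSystem (fun i => Module.Dual k (H i)) (fun i j h => f i j h) :=
    { map_self := fun i x => LinearMap.ext fun y => congrArg x (τ_self i y)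
      map_map := fun _ _ _ hij hjl x => LinearMap.ext fun y => congrArg x (τ_comp _ _ _ hij hjl y) }
  let E := Module.DirectLimit (fun i => Module.Dual k (H i)) f
  let o : ∀ i, Module.Dual k (H i) →ₗ[k] E := Module.DirectLimit.of k ι _ f
  have hof : ∀ i j (h : i ≤ j) x, o j (f i j h x) = o i x := fun i j h x => Module.DirectLimit.of_f
  have hfρ : ∀ i j (h : i ≤ j), f i j h (ρ i) = ρ j := fun i j h => LinearMap.ext (hρ i j h)
  have hoρ : ∀ i j, o i (ρ i) = o j (ρ j) := by
    intro i j
    obtain ⟨l, hil, hjl⟩ := exists_ge_ge i j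
    rw [← hof i l hil, ← hof j l hjl, hfρ, hfρ]
  -- An element that vanishes in a direct limit already vanishes at some stage `j`, but `ρ j` takes
  -- the value `1`.
  have hne0 : o i₀ (ρ i₀) ≠ 0 := by
    intro h0
    obtain ⟨j, hj, h⟩ := Module.DirectLimit.of.zero_exact h0
    obtain ⟨x, hx⟩ := hne j
    rw [hfρ] at h
    simp [h] at hx
  let _ : AddCommGroup E := Module.addCommMonoidToAddCommGroup k
  obtain ⟨F, hF⟩ : ∃ F : Module.Dual k E, F (o i₀ (ρ i₀)) ≠ 0 := by
    by_contra! h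
    exact hne0 ((Module.forall_dual_apply_eq_zero_iff k _).1 h)
  let F' : Module.Dual k E := (F (o i₀ (ρ i₀)))⁻¹ • F
  -- By reflexivity, the restriction of `F'` to the dual of `H i` is evaluation at a vector; these
  -- vectors are the required family.
  have key : ∀ i (g : Module.Dual k (H i)),
      g ((Module.evalEquiv k (H i)).symm (F' ∘ₗ o i)) = F' (o i g) := fun i g =>
    Module.apply_evalEquiv_symm_apply k (H i) g _
  refine ⟨fun i => (Module.evalEquiv k (H i)).symm (F' ∘ₗ o i), fun i j hij => ?_, fun i => ?_⟩
  · rw [← sub_eq_zero, ← Module.forall_dual_apply_eq_zero_iff k]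
    intro g
    rw [map_sub, key, sub_eq_zero, ← hof i j hij]
    exact key j (f i j hij g)
  · rw [key, hoρ i i₀]
    exact inv_mul_cancel₀ hF

/-! ### The action of the completed group algebra through finite levels -/

section Levels

variable (k : Type uk) [Field k] {G : Type uG} [Group G] [TopologicalSpace G]

theorem groupElement_mul (g h : G) :
    groupElement k (g * h) = groupElement k g * groupElement k h :=
  Subtype.ext <| funext fun N =>
    map_mul (MonoidAlgebra.of k (G ⧸ N.toSubgroup)) (QuotientGroup.mk g) (QuotientGroup.mk h)

theorem inclusionAlgHom_groupElement (H : Subgroup G) (h : H) :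
    inclusionAlgHom k H (groupElement k h) = groupElement k (h : G) :=
  Subtype.ext <| funext fun N => by
    change MonoidAlgebra.mapDomainAlgHom k k _ (MonoidAlgebra.of k _ _) = MonoidAlgebra.of k _ _
    simp only [MonoidAlgebra.of_apply, MonoidAlgebra.mapDomainAlgHom_apply,
      MonoidAlgebra.mapDomain_single]
    rfl

variable {k}

theorem groupElement_sub_one_level {N : OpenNormalSubgroup G} {g : G} (hg : g ∈ N.toSubgroup) :
    (groupElement k g - 1).1 N = 0 := by
  change MonoidAlgebra.of k (G ⧸ N.toSubgroup) (QuotientGroup.mk g) - 1 = 0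
  rw [(QuotientGroup.eq_one_iff g).2 hg, map_one, sub_self]

/-- A basic neighbourhood constrains finitely many coordinates, and any `N` below all of them
controls them through the transition maps. -/
theorem exists_level_of_mem_nhds_zero {O : Set (CompletedGroupAlgebra k G)}
    (hO : O ∈ 𝓝 (0 : CompletedGroupAlgebra k G)) :
    ∃ N : OpenNormalSubgroup G, ∀ a : CompletedGroupAlgebra k G, a.1 N = 0 → a ∈ O := by
  let _ : ∀ N : OpenNormalSubgroup G, TopologicalSpace (FiniteLevel k G N) := fun _ => ⊥
  obtain ⟨t, ht, htO⟩ := (mem_nhds_induced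
    (fun x : CompletedGroupAlgebra k G => (x.1 : ∀ N : OpenNormalSubgroup G, FiniteLevel k G N))
    0 O).1 hO
  rw [nhds_pi, Filter.mem_pi] at ht
  obtain ⟨I, hI, s, hs, hst⟩ := ht
  have : Nonempty (OpenNormalSubgroup G) := ⟨⟨⊤, inferInstanceAs (⊤ : Subgroup G).Normal⟩⟩
  obtain ⟨N, hN⟩ := hI.bddBelow
  refine ⟨N, fun a ha => htO (hst fun M hM => ?_)⟩
  have h0 : a.1 M = 0 := by rw [← a.2 N M (hN hM), ha, map_zero]
  change a.1 M ∈ s M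
  rw [h0]
  exact mem_of_mem_nhds (hs M)

/-- The group algebra acts on a quotient by an open submodule of finite codimension through a
finite level. -/
theorem exists_level_smul_mem {U : Type uU} [AddCommGroup U] [Module k U]
    [Module (CompletedGroupAlgebra k G) U] [IsScalarTower k (CompletedGroupAlgebra k G) U]
    [TopologicalSpace U] [ContinuousSMul (CompletedGroupAlgebra k G) U]
    {V : Submodule (CompletedGroupAlgebra k G) U}
    (hV : IsOpenCofinite k (CompletedGroupAlgebra k G) V) :
    ∃ N : OpenNormalSubgroup G, ∀ a : CompletedGroupAlgebra k G, a.1 N = 0 →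
      ∀ u : U, a • u ∈ V := by
  obtain ⟨hopen, hfin⟩ := hV
  obtain ⟨s, hs⟩ := hfin.fg_top
  -- Finite codimension leaves one open condition on `a` for each of finitely many spanning vectors.
  have hO : (⋂ q ∈ s, {a : CompletedGroupAlgebra k G | a • Quotient.out q ∈ V}) ∈
      𝓝 (0 : CompletedGroupAlgebra k G) := by
    refine (Filter.biInter_finset_mem s).2 fun q _ => ?_
    refine (hopen.preimage (continuous_id.smul continuous_const)).mem_nhds ?_
    simp
  obtain ⟨N, hN⟩ := exists_level_of_mem_nhds_zero hO
  refine ⟨N, fun a ha u => ?_⟩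
  rw [← Submodule.Quotient.mk_eq_zero, Submodule.Quotient.mk_smul]
  generalize (Submodule.Quotient.mk u : U ⧸ V) = w
  have hmem : w ∈ Submodule.span k (s : Set (U ⧸ V)) := by
    rw [hs]; trivial
  induction hmem using Submodule.span_induction with
  | mem q hq =>
    have h := Set.mem_iInter₂.1 (hN a ha) q hq
    have hq' : (Submodule.Quotient.mk (Quotient.out q) : U ⧸ V) = q := Quotient.out_eq' q
    rw [← hq', ← Submodule.Quotient.mk_smul, Submodule.Quotient.mk_eq_zero]
    exact h
  | zero => exact smul_zero a
  | add x y _ _ hx hy => rw [smul_add, hx, hy, add_zero]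
  | smul c x _ hx => rw [smul_comm, hx, smul_zero]

/-- An equivariant `k`-linear map through which the group algebra acts at a finite level is linear
over the completed group algebra. -/
theorem map_smul_of_level {U : Type uU} [AddCommGroup U] [Module k U]
    [Module (CompletedGroupAlgebra k G) U] [IsScalarTower k (CompletedGroupAlgebra k G) U]
    {Q : Type uV} [AddCommGroup Q] [Module k Q]
    [Module (CompletedGroupAlgebra k G) Q] [IsScalarTower k (CompletedGroupAlgebra k G) Q]
    (f : U →ₗ[k] Q) (hf : ∀ (g : G) u, f (groupElement k g • u) = groupElement k g • f u)
    (N : OpenNormalSubgroup G)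
    (hU : ∀ a : CompletedGroupAlgebra k G, a.1 N = 0 → ∀ u, f (a • u) = 0)
    (hQ : ∀ a : CompletedGroupAlgebra k G, a.1 N = 0 → ∀ q : Q, a • q = 0)
    (a : CompletedGroupAlgebra k G) (u : U) : f (a • u) = a • f u := by
  -- Each element of `k[G/N]` lifts to a finite combination of group elements, with which `f`
  -- commutes; `a` differs from such a lift by an element of level `N` zero, invisible on both
  -- sides.
  have key : ∀ x : FiniteLevel k G N, ∃ c : CompletedGroupAlgebra k G,
      c.1 N = x ∧ ∀ u, f (c • u) = c • f u := by
    intro x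
    induction x using MonoidAlgebra.induction_on with
    | of m =>
      obtain ⟨g, rfl⟩ := QuotientGroup.mk_surjective m
      exact ⟨groupElement k g, rfl, hf g⟩
    | add x y hx hy =>
      obtain ⟨c, rfl, hc⟩ := hx
      obtain ⟨d, rfl, hd⟩ := hy
      exact ⟨c + d, rfl, fun u => by rw [add_smul, map_add, hc, hd, add_smul]⟩
    | smul r x hx =>
      obtain ⟨c, rfl, hc⟩ := hx
      exact ⟨r • c, rfl, fun u => by rw [smul_assoc, map_smul, hc, smul_assoc]⟩
  obtain ⟨c, hc, h⟩ := key (a.1 N)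
  have hac : (a - c).1 N = 0 := by
    change a.1 N - c.1 N = 0
    rw [hc, sub_self]
  have h1 := hU _ hac u
  have h2 := hQ _ hac (f u)
  rw [sub_smul, map_sub, sub_eq_zero] at h1
  rw [sub_smul, sub_eq_zero] at h2
  rw [h1, h2, h]

end Levels

/-! ### Averaging an equivariant map -/

section Trace

variable {k : Type uk} [Field k] {G : Type uG} [Group G] [TopologicalSpace G]
  {U : Type uU} [AddCommGroup U] [Module k U]
  [Module (CompletedGroupAlgebra k G) U] [IsScalarTower k (CompletedGroupAlgebra k G) U]
  {Q : Type uV} [AddCommGroup Q] [Module k Q]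
  [Module (CompletedGroupAlgebra k G) Q] [IsScalarTower k (CompletedGroupAlgebra k G) Q]

/-- The summand `u ↦ g a γ(g⁻¹ u)` of the trace of `a γ`. -/
def traceSummand (a : CompletedGroupAlgebra k G) (γ : U →ₗ[k] Q) (g : G) : U →ₗ[k] Q :=
  Algebra.lsmul k k Q (groupElement k g * a) ∘ₗ γ ∘ₗ Algebra.lsmul k k U (groupElement k g⁻¹)

theorem traceSummand_apply (a : CompletedGroupAlgebra k G) (γ : U →ₗ[k] Q) (g : G) (u : U) :
    traceSummand a γ g u = (groupElement k g * a) • γ (groupElement k g⁻¹ • u) := rfl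

/-- The summand depends only on the coset `gH`: moving `h⁻¹` across `γ` produces `h a h⁻¹ = a`. -/
theorem traceSummand_mul {H : Subgroup G} {a : CompletedGroupAlgebra k G}
    (ha : a ∈ fixedPoints k H) {γ : U →ₗ[k] Q}
    (hγ : ∀ h ∈ H, ∀ u, γ (groupElement k h • u) = groupElement k h • γ u) (g : G) {h : G}
    (hh : h ∈ H) : traceSummand a γ (g * h) = traceSummand a γ g := by
  ext u
  have hc : groupElement k h * a * groupElement k h⁻¹ = a := ha h hh
  rw [traceSummand_apply, traceSummand_apply, mul_inv_rev, groupElement_mul k h⁻¹,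
    mul_smul (groupElement k h⁻¹), hγ _ (H.inv_mem hh), ← mul_smul, groupElement_mul, mul_assoc, mul_assoc,
    ← mul_assoc (groupElement k h), hc]

theorem traceSummand_out {H : Subgroup G} {a : CompletedGroupAlgebra k G}
    (ha : a ∈ fixedPoints k H) {γ : U →ₗ[k] Q}
    (hγ : ∀ h ∈ H, ∀ u, γ (groupElement k h • u) = groupElement k h • γ u) (g : G) :
    traceSummand a γ (QuotientGroup.mk g : G ⧸ H).out = traceSummand a γ g := by
  obtain ⟨h, hh⟩ := QuotientGroup.mk_out_eq_mul H g
  rw [hh, traceSummand_mul ha hγ g h.2]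

theorem traceSummand_smul (a : CompletedGroupAlgebra k G) (γ : U →ₗ[k] Q) (x g : G) (u : U) :
    traceSummand a γ g (groupElement k x • u) =
      groupElement k x • traceSummand a γ (x⁻¹ * g) u := by
  rw [traceSummand_apply, traceSummand_apply, mul_inv_rev, inv_inv, groupElement_mul k g⁻¹,
    mul_smul (groupElement k g⁻¹), ← mul_smul (groupElement k x), ← mul_assoc, ← groupElement_mul,
    mul_inv_cancel_left]

/-- If `e` is a trace from `H`, an `H`-equivariant lift of `φ` gives rise to a `G`-equivariant lift
of `e φ`. -/
theorem exists_equivariant_lift_of_trace {H : Subgroup G} [Finite (G ⧸ H)]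
    {a : CompletedGroupAlgebra k G} (ha : a ∈ fixedPoints k H) {γ : U →ₗ[k] Q}
    (hγ : ∀ h ∈ H, ∀ u, γ (groupElement k h • u) = groupElement k h • γ u)
    {R : Type uW} [AddCommGroup R] [Module (CompletedGroupAlgebra k G) R]
    (β : Q →ₗ[CompletedGroupAlgebra k G] R) (φ : U →ₗ[CompletedGroupAlgebra k G] R)
    (h : ∀ u, β (γ u) = φ u) :
    ∃ γ' : U →ₗ[k] Q,
      (∀ (g : G) u, γ' (groupElement k g • u) = groupElement k g • γ' u) ∧
      (∀ u, β (γ' u) = traceMap k H a • φ u) ∧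
      -- This clause carries continuity: a submodule killed by `γ` is killed by `γ'`.
      ∀ u, (∀ g : G, γ (groupElement k g • u) = 0) → γ' u = 0 := by
  have := Fintype.ofFinite (G ⧸ H)
  refine ⟨∑ q : G ⧸ H, traceSummand a γ q.out, fun g u => ?_, fun u => ?_, fun u hu => ?_⟩
  · simp only [LinearMap.sum_apply, Finset.smul_sum]
    -- Translation by `g⁻¹` permutes the cosets, and the summands do not depend on the
    -- representatives.
    refine Fintype.sum_equiv (MulAction.toPerm g⁻¹) _ _ fun q => ?_
    rw [traceSummand_smul, MulAction.toPerm_apply]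
    obtain ⟨y, rfl⟩ := QuotientGroup.mk_surjective q
    rw [← traceSummand_out ha hγ (g⁻¹ * _)]
    congr 4
    rw [← smul_eq_mul, ← MulAction.Quotient.smul_mk, QuotientGroup.out_eq']
  · rw [traceMap, finsum_eq_sum_of_fintype, Finset.sum_smul, LinearMap.sum_apply, map_sum]
    refine Finset.sum_congr rfl fun q _ => ?_
    rw [traceSummand_apply, map_smul, h, map_smul, ← mul_smul, conjAction]
  · rw [LinearMap.sum_apply]
    refine Finset.sum_eq_zero fun q _ => ?_
    rw [traceSummand_apply, hu, smul_zero]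

end Trace

/-! ### Lifting modulo open submodules -/

section Lifting

/-- Since `BU = U`, it suffices that `e (a e) = a e`, which holds as `e` is central and idempotent.
-/
theorem LiesInBlock.idempotent_smul {A : Type uA} [Ring A] {B : Block A} {U : Type uU}
    [AddCommGroup U] [Module A U] (h : LiesInBlock B U) (u : U) : B.idempotent • u = u := by
  have hu : u ∈ B.toIdeal • (⊤ : Submodule A U) := by rw [h.1]; trivial
  refine Submodule.smul_induction_on hu (fun r hr n _ => ?_) fun x y hx hy => ?_
  · obtain ⟨a, rfl⟩ := Submodule.mem_span_singleton.1 hr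
    rw [← mul_smul, smul_eq_mul, ← mul_assoc,
      ← Subring.mem_center_iff.1 B.isCentrallyPrimitive.mem_center a, mul_assoc,
      B.isCentrallyPrimitive.isIdempotentElem.eq]
  · rw [smul_add, hx, hy]

variable {k : Type uk} [Field k] {G : Type uG} [Group G] [TopologicalSpace G]
  {U : Type uU} [AddCommGroup U] [Module k U]
  [Module (CompletedGroupAlgebra k G) U] [IsScalarTower k (CompletedGroupAlgebra k G) U]
  [TopologicalSpace U]
  {V : Type uV} [AddCommGroup V] [Module k V]
  [Module (CompletedGroupAlgebra k G) V] [IsScalarTower k (CompletedGroupAlgebra k G) V]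
  [TopologicalSpace V]
  {W : Type uW} [AddCommGroup W] [Module (CompletedGroupAlgebra k G) W]

theorem level_eq_zero_of_le {N M : OpenNormalSubgroup G} (h : N ≤ M)
    {a : CompletedGroupAlgebra k G} (ha : a.1 N = 0) : a.1 M = 0 := by
  rw [← a.2 N M h, ha, map_zero]

/-- The map `V/V' → W/β(V')` induced by `β`. -/
def quotientMap (β : V →ₗ[CompletedGroupAlgebra k G] W)
    (V' : Submodule (CompletedGroupAlgebra k G) V) :
    (V ⧸ V') →ₗ[CompletedGroupAlgebra k G] (W ⧸ V'.map β) :=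
  V'.mapQ (V'.map β) β (Submodule.le_comap_map β V')

/-- The `k`-linear map underlying a continuous homomorphism of restricted modules. -/
def IsContinuousRestrictedHom.toLinearMap {H : Subgroup G} {γ : U →+ V}
    (hγ : IsContinuousRestrictedHom k H γ) : U →ₗ[k] V :=
  { γ with
    map_smul' := fun c u => by
      have h := hγ.2 (algebraMap k _ c) u
      rw [AlgHom.commutes, algebraMap_smul, algebraMap_smul] at h
      exact h }

variable [IsTopologicalGroup G] [CompactSpace G]

theorem exists_lift_mod_isOpenCofinite {e : CompletedGroupAlgebra k G} {D : Subgroup G}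
    (he : e ∈ openTraceSet k D) (heU : ∀ u : U, e • u = u)
    (hU : IsPseudocompactModule k (CompletedGroupAlgebra k G) U)
    (hV : IsPseudocompactModule k (CompletedGroupAlgebra k G) V)
    (φ : U →ₗ[CompletedGroupAlgebra k G] W) (β : V →ₗ[CompletedGroupAlgebra k G] W)
    {γ : U →+ V} (hγ : IsContinuousRestrictedHom k D γ) (hβγ : ∀ u, β (γ u) = φ u)
    {V' : Submodule (CompletedGroupAlgebra k G) V}
    (hV' : IsOpenCofinite k (CompletedGroupAlgebra k G) V') :
    ∃ f : U →ₗ[CompletedGroupAlgebra k G] V ⧸ V', IsOpen (LinearMap.ker f : Set U) ∧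
      ∀ u, quotientMap β V' (f u) = (V'.map β).mkQ (φ u) := by
  have := hU.continuousSMul
  have := hV.continuousSMul
  have := hU.isTopologicalAddGroup
  obtain ⟨U', hU', hγU'⟩ : ∃ U' : Submodule (CompletedGroupAlgebra k G) U,
      IsOpenCofinite k (CompletedGroupAlgebra k G) U' ∧ (U' : Set U) ⊆ γ ⁻¹' V' :=
    hU.hasBasis.mem_iff.1 ((hV'.1.preimage hγ.1).mem_nhds (by simp))
  obtain ⟨N₁, hN₁⟩ := exists_level_smul_mem hU'
  obtain ⟨N₂, hN₂⟩ := exists_level_smul_mem hV'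
  -- `N` acts trivially on both `U/U'` and `V/V'`, so the reduction of `γ` becomes equivariant for
  -- `DN`, not only for `D`.
  obtain ⟨N, hNN₁, hNN₂⟩ : ∃ N : OpenNormalSubgroup G, N ≤ N₁ ∧ N ≤ N₂ :=
    ⟨N₁ ⊓ N₂, inf_le_left, inf_le_right⟩
  obtain ⟨a, ha, rfl⟩ := Set.mem_iInter.1 he N
  have := Subgroup.quotient_finite_of_isOpen (D ⊔ N.toSubgroup)
    (Subgroup.isOpen_mono le_sup_right N.toOpenSubgroup.isOpen)
  let γ' : U →ₗ[k] V ⧸ V' := V'.mkQ.restrictScalars k ∘ₗ hγ.toLinearMap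
  have hγ'0 : ∀ u ∈ U', γ' u = 0 := fun u hu => (Submodule.Quotient.mk_eq_zero V').2 (hγU' hu)
  have hγ' : ∀ h ∈ D ⊔ N.toSubgroup, ∀ u,
      γ' (groupElement k h • u) = groupElement k h • γ' u := by
    intro h hh u
    obtain ⟨d, hd, n, hn, rfl⟩ := Subgroup.mem_sup_of_normal_right.1 hh
    have hn0 := groupElement_sub_one_level (k := k) hn
    have h1 : γ' (groupElement k d • groupElement k n • u) =
        groupElement k d • γ' (groupElement k n • u) := by
      have h := hγ.2 (groupElement k ⟨d, hd⟩) (groupElement k n • u)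
      rw [inclusionAlgHom_groupElement] at h
      exact congrArg V'.mkQ h
    have h2 : γ' (groupElement k n • u) = γ' u := by
      have h := hγ'0 _ (hN₁ _ (level_eq_zero_of_le hNN₁ hn0) u)
      rwa [sub_smul, one_smul, map_sub, sub_eq_zero] at h
    have h3 : groupElement k n • γ' u = γ' u := by
      have h := (Submodule.Quotient.mk_eq_zero V').2
        (hN₂ _ (level_eq_zero_of_le hNN₂ hn0) (γ u))
      rwa [Submodule.Quotient.mk_smul, sub_smul, one_smul, sub_eq_zero] at h
    rw [groupElement_mul, mul_smul, h1, h2, mul_smul, h3]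
  obtain ⟨f, hfG, hfφ, hf0⟩ := exists_equivariant_lift_of_trace ha hγ' (quotientMap β V')
    ((V'.map β).mkQ ∘ₗ φ) (fun u => congrArg (V'.map β).mkQ (hβγ u))
  have hf0' : ∀ u ∈ U', f u = 0 := fun u hu => hf0 u fun g => hγ'0 _ (U'.smul_mem _ hu)
  refine ⟨{ f with map_smul' := map_smul_of_level f hfG N (fun b hb u => hf0' _ ?_) fun b hb q => ?_ }, ?_, fun u => ?_⟩
  · exact hN₁ _ (level_eq_zero_of_le hNN₁ hb) u
  · obtain ⟨v, rfl⟩ := Submodule.Quotient.mk_surjective V' q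
    rw [← Submodule.Quotient.mk_smul, Submodule.Quotient.mk_eq_zero]
    exact hN₂ _ (level_eq_zero_of_le hNN₂ hb) v
  · exact AddSubgroup.isOpen_mono (H₁ := U'.toAddSubgroup)
      (H₂ := (LinearMap.ker _).toAddSubgroup) hf0' hU'.1
  · refine (hfφ u).trans ?_
    -- Here `e φ(u) = φ(e u) = φ(u)`.
    rw [← map_smul, heU]
    rfl

end Lifting

/-! ### Passing to the limit -/

section Limit

theorem IsOpenCofinite.inf {k : Type uk} [Field k] {A : Type uA} [Ring A] [Algebra k A]
    {V : Type uV} [AddCommGroup V] [Module k V] [Module A V] [IsScalarTower k A V]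
    [TopologicalSpace V]
    {V₁ V₂ : Submodule A V} (h₁ : IsOpenCofinite k A V₁)
    (h₂ : IsOpenCofinite k A V₂) : IsOpenCofinite k A (V₁ ⊓ V₂) := by
  refine ⟨h₁.1.inter h₂.1, ?_⟩
  have := h₁.2
  have := h₂.2
  let f : (V ⧸ V₁ ⊓ V₂) →ₗ[k] (V ⧸ V₁) × (V ⧸ V₂) :=
    ((Submodule.factor inf_le_left).prod (Submodule.factor inf_le_right)).restrictScalars k
  refine FiniteDimensional.of_injective f ((injective_iff_map_eq_zero f).2 fun q hq => ?_)
  obtain ⟨v, rfl⟩ := Submodule.Quotient.mk_surjective _ q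
  obtain ⟨h1, h2⟩ := Prod.ext_iff.1 hq
  exact (Submodule.Quotient.mk_eq_zero _).2
    ⟨(Submodule.Quotient.mk_eq_zero _).1 h1, (Submodule.Quotient.mk_eq_zero _).1 h2⟩

/-- The homomorphisms from a finitely generated module to a finite-dimensional one form a
finite-dimensional space. -/
theorem finiteDimensional_linearMap {k : Type uk} [Field k] {A : Type uA} [Ring A] [Algebra k A]
    {U : Type uU} [AddCommGroup U] [Module A U] [Module.Finite A U] {Q : Type*} [AddCommGroup Q] [Module k Q]
    [Module A Q] [IsScalarTower k A Q] [FiniteDimensional k Q] :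
    FiniteDimensional k (U →ₗ[A] Q) := by
  obtain ⟨s, hs⟩ := Module.Finite.fg_top (R := A) (M := U)
  let f : (U →ₗ[A] Q) →ₗ[k] (s → Q) :=
    { toFun := fun h i => h i
      map_add' := fun _ _ => rfl
      map_smul' := fun _ _ => rfl }
  exact FiniteDimensional.of_injective f fun g h hgh =>
    LinearMap.ext_on hs fun x hx => congrFun hgh ⟨x, hx⟩

variable {k : Type uk} [Field k] {A : Type uA} [Ring A] [Algebra k A] [TopologicalSpace A]
  {U : Type uU} [AddCommGroup U] [Module A U] [TopologicalSpace U]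
  {V : Type uV} [AddCommGroup V] [Module k V] [Module A V] [IsScalarTower k A V]
  [TopologicalSpace V]
  {W : Type uW} [AddCommGroup W] [Module k W] [Module A W] [IsScalarTower k A W]
  [TopologicalSpace W]

variable [IsTopologicalAddGroup U]

variable (k) in
/-- The pairs `(f, c)` of a homomorphism `f : U → Q` with open kernel and a scalar `c` such that
`β f = c φ`. -/
def scaledLifts {Q : Type*} [AddCommGroup Q] [Module k Q] [Module A Q] [IsScalarTower k A Q]
    {R : Type*} [AddCommGroup R] [Module k R] [Module A R] [IsScalarTower k A R]
    (β : Q →ₗ[A] R) (φ : U →ₗ[A] R) : Submodule k ((U →ₗ[A] Q) × k) where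
  carrier := {x | IsOpen (LinearMap.ker x.1 : Set U) ∧ β ∘ₗ x.1 = x.2 • φ}
  add_mem' := by
    rintro x y ⟨hx, hx'⟩ ⟨hy, hy'⟩
    refine ⟨AddSubgroup.isOpen_mono
      (H₁ := (LinearMap.ker x.1 ⊓ LinearMap.ker y.1).toAddSubgroup)
      (H₂ := (LinearMap.ker (x + y).1).toAddSubgroup) ?_ (hx.inter hy), ?_⟩
    · rintro u ⟨h1, h2⟩
      change x.1 u + y.1 u = 0
      rw [LinearMap.mem_ker.1 h1, LinearMap.mem_ker.1 h2, add_zero]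
    · rw [Prod.fst_add, Prod.snd_add, LinearMap.comp_add, hx', hy', add_smul]
  zero_mem' := by
    refine ⟨?_, by simp⟩
    rw [Prod.fst_zero, LinearMap.ker_zero]
    exact isOpen_univ
  smul_mem' := by
    rintro c x ⟨hx, hx'⟩
    refine ⟨AddSubgroup.isOpen_mono (H₁ := (LinearMap.ker x.1).toAddSubgroup)
      (H₂ := (LinearMap.ker (c • x).1).toAddSubgroup) ?_ hx, ?_⟩
    · intro u hu
      change c • x.1 u = 0
      rw [LinearMap.mem_ker.1 hu, smul_zero]
    · ext u
      have h := LinearMap.congr_fun hx' u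
      change β (x.1 u) = x.2 • φ u at h
      change β (c • x.1 u) = (c • x.2) • φ u
      rw [LinearMap.map_smul_of_tower, h, smul_assoc]

/-- A homomorphism that lifts with open kernel modulo each open submodule of finite codimension
lifts continuously. -/
theorem exists_continuous_lift [Module.Finite A U]
    (hV : IsPseudocompactModule k A V) (hW : IsPseudocompactModule k A W)
    (φ : U →ₗ[A] W) (β : V →L[A] W)
    (h : ∀ V' : Submodule A V, IsOpenCofinite k A V' →
      ∃ f : U →ₗ[A] V ⧸ V', IsOpen (LinearMap.ker f : Set U) ∧
        ∀ u, V'.mapQ (V'.map β.toLinearMap) β.toLinearMap (Submodule.le_comap_map _ V') (f u) =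
          (V'.map β.toLinearMap).mkQ (φ u)) :
    ∃ γ : U →L[A] V, ∀ u, β (γ u) = φ u := by
  -- Reverse inclusion, so that intersections are upper bounds and the system is directed.
  let ι := {V' : Submodule A V // IsOpenCofinite k A V'}ᵒᵈ
  let X : ι → Submodule A V := fun i => (OrderDual.ofDual i).1
  have hX : ∀ i, IsOpenCofinite k A (X i) := fun i => (OrderDual.ofDual i).2
  have hXle : ∀ i j : ι, i ≤ j → X j ≤ X i := fun _ _ hij => hij
  have : IsDirectedOrder ι := ⟨fun i j =>
    ⟨OrderDual.toDual ⟨X i ⊓ X j, (hX i).inf (hX j)⟩, inf_le_left (a := X i), inf_le_right (b := X j)⟩⟩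
  let Y : ι → Submodule A W := fun i => (X i).map β.toLinearMap
  let b : ∀ i, (V ⧸ X i) →ₗ[A] (W ⧸ Y i) := fun i =>
    (X i).mapQ (Y i) β.toLinearMap (Submodule.le_comap_map _ _)
  let L : ∀ i, Submodule k ((U →ₗ[A] V ⧸ X i) × k) := fun i =>
    scaledLifts k (b i) ((Y i).mkQ ∘ₗ φ)
  have : ∀ i, FiniteDimensional k (V ⧸ X i) := fun i => (hX i).2
  have : ∀ i, FiniteDimensional k (U →ₗ[A] V ⧸ X i) := fun i => finiteDimensional_linearMap
  let t : ∀ i j, i ≤ j → (U →ₗ[A] V ⧸ X j) →ₗ[k] (U →ₗ[A] V ⧸ X i) := fun i j hij =>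
    { toFun := fun f => Submodule.factor (hXle i j hij) ∘ₗ f
      map_add' := fun f g => LinearMap.comp_add _ _ _
      map_smul' := fun c f => LinearMap.ext fun u =>
        LinearMap.map_smul_of_tower (Submodule.factor (hXle i j hij)) c (f u) }
  have ht : ∀ i j hij, ∀ x ∈ L j, ((t i j hij).prodMap LinearMap.id) x ∈ L i := by
    rintro i j hij ⟨f, c⟩ ⟨hf, hf'⟩
    refine ⟨AddSubgroup.isOpen_mono (H₁ := (LinearMap.ker f).toAddSubgroup)
      (H₂ := (LinearMap.ker (t i j hij f)).toAddSubgroup) (LinearMap.ker_le_ker_comp _ _) hf, ?_⟩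
    have hY : Y j ≤ Y i := Submodule.map_mono (hXle i j hij)
    have hbt : ∀ q, b i (Submodule.factor (hXle i j hij) q) = Submodule.factor hY (b j q) := by
      intro q
      obtain ⟨v, rfl⟩ := Submodule.Quotient.mk_surjective _ q
      rfl
    ext u
    refine (hbt (f u)).trans ?_
    have := LinearMap.congr_fun hf' u
    change b j (f u) = c • (Y j).mkQ (φ u) at this
    rw [this, LinearMap.map_smul_of_tower]
    rfl
  obtain ⟨x, hx, hx1⟩ := exists_compatible_family_eq_one (fun i => L i)
    (fun i j hij => ((t i j hij).prodMap LinearMap.id).restrict (ht i j hij))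
    (fun i x => by
      refine Subtype.ext (Prod.ext (LinearMap.ext fun u => ?_) rfl)
      change Submodule.factor (hXle i i le_rfl) (x.1.1 u) = x.1.1 u
      obtain ⟨v, hv⟩ := Submodule.Quotient.mk_surjective _ (x.1.1 u)
      rw [← hv]
      rfl)
    (fun i j l hij hjl x => by
      refine Subtype.ext (Prod.ext (LinearMap.ext fun u => ?_) rfl)
      exact Submodule.factor_comp_apply (hXle j l hjl) (hXle i j hij) (x.1.1 u))
    -- The functional is the scalar coordinate; the value `1` singles out genuine lifts.
    (fun i => LinearMap.snd k _ _ ∘ₗ (L i).subtype) (fun _ _ _ _ => rfl)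
    (fun i => by
      obtain ⟨f, hf, hf'⟩ := h (X i) (hX i)
      exact ⟨⟨(f, 1), hf, LinearMap.ext fun u => (hf' u).trans (one_smul k _).symm⟩, rfl⟩)
  have hsep : ∀ v w : V, (∀ i, (X i).mkQ v = (X i).mkQ w) → v = w := by
    intro v w hvw
    rw [← sub_eq_zero, ← Submodule.mem_bot A, ← hV.sInf_eq_bot, Submodule.mem_sInf]
    exact fun V' hV' => (Submodule.Quotient.eq V').1 (hvw (OrderDual.toDual ⟨V', hV'⟩))
  have hex : ∀ u, ∃ v : V, ∀ i, (X i).mkQ v = (x i).1.1 u := by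
    intro u
    obtain ⟨v, hv⟩ := hV.complete (fun V' => (x (OrderDual.toDual V')).1.1 u)
      (fun V₁ V₂ hle => LinearMap.congr_fun (congrArg (fun y => y.1.1)
        (hx (OrderDual.toDual V₂) (OrderDual.toDual V₁) hle)) u)
    exact ⟨v, fun i => hv (OrderDual.ofDual i)⟩
  choose γ hγ using hex
  let γ' : U →ₗ[A] V :=
    { toFun := γ
      map_add' := fun u v => hsep _ _ fun i => by rw [map_add, hγ, hγ, hγ, map_add]
      map_smul' := fun a u => hsep _ _ fun i => by
        rw [RingHom.id_apply, map_smul, hγ, hγ, map_smul] }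
  have := hV.isTopologicalAddGroup
  have hcont : Continuous γ' := by
    refine continuous_of_continuousAt_zero γ' ?_
    rw [ContinuousAt, map_zero]
    refine hV.hasBasis.tendsto_right_iff.2 fun V' hV' => ?_
    let i : ι := OrderDual.toDual ⟨V', hV'⟩
    filter_upwards [(x i).2.1.mem_nhds (zero_mem (LinearMap.ker (x i).1.1))] with u hu
    exact (Submodule.Quotient.mk_eq_zero V').1 ((hγ u i).trans hu)
  refine ⟨⟨γ', hcont⟩, fun u => ?_⟩
  rw [← sub_eq_zero, ← Submodule.mem_bot A, ← hW.sInf_eq_bot, Submodule.mem_sInf]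
  intro W' hW'
  -- The lifts control `β γ - φ` only modulo `β(V')`; continuity of `β` gives a `V'` with `β(V')`
  -- inside `W'`.
  obtain ⟨V', hV', hV'W'⟩ := hV.hasBasis.mem_iff.1
    ((hW'.1.preimage β.continuous).mem_nhds (by simp : (0 : V) ∈ β ⁻¹' (W' : Set W)))
  let i : ι := OrderDual.toDual ⟨V', hV'⟩
  have h1 := LinearMap.congr_fun (x i).2.2 u
  have h2 : (x i).1.2 = 1 := hx1 i
  rw [h2, one_smul, LinearMap.comp_apply, ← hγ u i] at h1
  obtain ⟨v, hv, hvw⟩ := (Submodule.Quotient.eq (Y i)).1 h1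
  change β (γ u) - φ u ∈ W'
  rw [← show β v = β (γ u) - φ u from hvw]
  exact hV'W' hv

end Limit

end

theorem mainTheorem11
    (p : ℕ) [Fact p.Prime] (k : Type uk) [Field k] [CharP k p]
    (G : Type uG) [Group G] [TopologicalSpace G] [IsTopologicalGroup G] [CompactSpace G]
    [TotallyDisconnectedSpace G]
    (B : Block (CompletedGroupAlgebra k G)) (D : Subgroup G) (hD : IsDefectGroup B D)
    (U : Type uU) [AddCommGroup U] [Module k U] [Module (CompletedGroupAlgebra k G) U]
    [IsScalarTower k (CompletedGroupAlgebra k G) U] [TopologicalSpace U]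
    (hU : IsPseudocompactModule k (CompletedGroupAlgebra k G) U)
    (hfg : Module.Finite (CompletedGroupAlgebra k G) U)
    (hB : LiesInBlock B U) :
    IsRelativelyProjective.{uk, uG, uU, uV, uW} k D U := by
  intro V _ _ _ _ _ W _ _ _ _ _ hV hW φ β _ ⟨γ, hγ, hβγ⟩
  have := hU.isTopologicalAddGroup
  exact exists_continuous_lift hV hW φ.toLinearMap β fun V' hV' =>
    exists_lift_mod_isOpenCofinite hD.prop.2 hB.idempotent_smul hU hV φ.toLinearMap β.toLinearMap
      hγ hβγ hV'
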